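/- Let $n$ be a positive integer with $n\equiv 1\pmod 6$ satisfying one of the following conditions: (a) $n\equiv 0\pmod 5$; (b) $n\ge 186$ and $n\equiv 1\pmod 5$; (c) $n\ge 125$ and $n\equiv 2\pmod 5$; (d) $n\equiv 3\pmod 5$; (e) $n\ge 83$ and $n\equiv 4\pmod 5$. Let $H$ be any (multiplicatively written) abelian group of order $n^2+n+1$ with identity element $e$. For a subset $D\subseteq H$ write $D$ also for the element $\sum_{g\in D}g$ of the group ring $\mathbb{Z}[H]$, and for $A=\sum_{g\in H}a_g g\in\mathbb{Z}[H]$ put $A^{(2)}=\sum_{g\in H}a_g g^2$. Then there are no inverse-closed subsets $T_0,T_1\subseteq H$ with $e\in T_0$ that satisfy both $$T_0T_1=H-e\qquad\text{and}\qquad T_0^2+T_1^2=2H-T_0^{(2)}-T_1^{(2)}+2ne$$ in $\mathbb{Z}[H]$. -/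

import Mathlib

namespace APLL

noncomputable section

/-- A finite subset `D` of a group `H`, viewed as the element `∑_{g ∈ D} g` of `ℤ[H]`. -/
def ofSubset {H : Type*} (D : Finset H) : MonoidAlgebra ℤ H :=
  ∑ g ∈ D, MonoidAlgebra.single g (1 : ℤ)

/-- For `A = ∑ a_g g` in `ℤ[H]` and `t : ℤ`, the element `A^{(t)} = ∑ a_g g^t` of `ℤ[H]`
(coefficients of coinciding powers add up). -/
def powerMap {H : Type*} [Group H] (t : ℤ) (A : MonoidAlgebra ℤ H) : MonoidAlgebra ℤ H :=
  MonoidAlgebra.mapDomain (fun g : H => g ^ t) A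

/-- A subset of a group is inverse-closed if it contains the inverse of each of its elements. -/
def InverseClosed {H : Type*} [Group H] (D : Finset H) : Prop :=
  ∀ g ∈ D, g⁻¹ ∈ D

/-- `T₀, T₁ ⊆ H` are inverse-closed, `e ∈ T₀`, and in `ℤ[H]` both group ring equations
`T₀ T₁ = H - e` and `T₀² + T₁² = 2 H - T₀^{(2)} - T₁^{(2)} + 2 n e` hold. -/
structure IsSolution {H : Type*} [CommGroup H] [Fintype H] (n : ℕ) (T₀ T₁ : Finset H) :
    Prop where
  inv_closed_zero : InverseClosed T₀
  inv_closed_one : InverseClosed T₁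
  one_mem : (1 : H) ∈ T₀
  mul_eq : ofSubset T₀ * ofSubset T₁ = ofSubset (Finset.univ : Finset H) - 1
  sq_add_sq_eq : ofSubset T₀ ^ 2 + ofSubset T₁ ^ 2 =
    (2 : ℤ) • ofSubset (Finset.univ : Finset H) - powerMap 2 (ofSubset T₀)
      - powerMap 2 (ofSubset T₁) + (2 * (n : ℤ)) • (1 : MonoidAlgebra ℤ H)

end

end APLL

namespace APLL

/-! Since `n ≡ 1 [MOD 3]`, 3 divides `|H|`, so `H` has a nontrivial cubic character `χ`. It kills
`H`, and on inverse-closed sets squaring acts as inversion, so `T` and `T^{(2)}` have equal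
`χ`-sums. With sums `a`, `b` the equations become `ab = -1` and `a² + b² = 2n - a - b`. As `2a`,
`2b` are integers, this forces `n = 1`. -/

/-- The ring homomorphism `ℤ[H] → ℂ` induced by a character of `H`. -/
noncomputable def charHom {H : Type*} [CommGroup H] (χ : H →* ℂ) : MonoidAlgebra ℤ H →ₐ[ℤ] ℂ :=
  MonoidAlgebra.lift ℤ ℂ H χ

theorem charHom_single {H : Type*} [CommGroup H] (χ : H →* ℂ) (g : H) :
    charHom χ (MonoidAlgebra.single g 1) = χ g := by
  simp [charHom]

theorem charHom_ofSubset {H : Type*} [CommGroup H] (χ : H →* ℂ) (D : Finset H) :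
    charHom χ (ofSubset D) = ∑ g ∈ D, χ g := by
  simp only [ofSubset, map_sum, charHom_single]

theorem charHom_powerMap_two {H : Type*} [CommGroup H] (χ : H →* ℂ) (D : Finset H) :
    charHom χ (powerMap 2 (ofSubset D)) = ∑ g ∈ D, χ g ^ 2 := by
  have h : powerMap 2 (ofSubset D) = ∑ g ∈ D, MonoidAlgebra.single (g ^ (2 : ℤ)) (1 : ℤ) := by
    simp only [powerMap, ofSubset]
    induction D using Finset.cons_induction with
    | empty => simp
    | cons a s ha ih =>
      rw [Finset.sum_cons, Finset.sum_cons, MonoidAlgebra.mapDomain_add, ih,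
        MonoidAlgebra.mapDomain_single]
  rw [h, map_sum]
  refine Finset.sum_congr rfl fun g _ => ?_
  rw [charHom_single, zpow_ofNat, map_pow]

/-- A sum over an inverse-closed set may be reindexed by inversion. -/
theorem InverseClosed.sum_inv {H M : Type*} [Group H] [AddCommMonoid M] {D : Finset H}
    (hD : InverseClosed D) (f : H → M) : ∑ g ∈ D, f g⁻¹ = ∑ g ∈ D, f g :=
  Finset.sum_nbij' (fun g => g⁻¹) (fun g => g⁻¹) hD hD (by simp) (by simp) (by simp)

theorem map_inv_eq_sq {H : Type*} [Group H] {χ : H →* ℂ} (h3 : ∀ g, χ g ^ 3 = 1) (g : H) :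
    χ g⁻¹ = χ g ^ 2 := by
  have h : χ g⁻¹ * χ g = 1 := by rw [← map_mul, inv_mul_cancel, map_one]
  linear_combination -χ g⁻¹ * h3 g + χ g ^ 2 * h

theorem sum_sq_eq_sum {H : Type*} [Group H] {χ : H →* ℂ} (h3 : ∀ g, χ g ^ 3 = 1)
    {D : Finset H} (hD : InverseClosed D) : ∑ g ∈ D, χ g ^ 2 = ∑ g ∈ D, χ g := by
  simp only [← map_inv_eq_sq h3]
  exact hD.sum_inv χ

/-- Twice a cubic character sum over an inverse-closed set is an integer. -/
theorem exists_int_eq_two_mul_sum {H : Type*} [Group H] {χ : H →* ℂ} (h3 : ∀ g, χ g ^ 3 = 1)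
    {D : Finset H} (hD : InverseClosed D) : ∃ m : ℤ, 2 * ∑ g ∈ D, χ g = m := by
  -- The sum is 2 or -1 according as `χ g` is 1 or a primitive cube root of unity.
  have hint : ∀ g, ∃ m : ℤ, χ g + χ g ^ 2 = m := fun g => by
    have h : (χ g - 1) * (χ g ^ 2 + χ g + 1) = 0 := by linear_combination h3 g
    rcases mul_eq_zero.mp h with h | h
    · exact ⟨2, by rw [sub_eq_zero.mp h]; norm_num⟩
    · exact ⟨-1, by push_cast; linear_combination h⟩
  choose f hf using hint
  refine ⟨∑ g ∈ D, f g, ?_⟩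
  push_cast
  simp only [← hf]
  rw [Finset.sum_add_distrib, sum_sq_eq_sum h3 hD, two_mul]

/-- A finite abelian group of order divisible by `3` has a nontrivial cubic character. -/
theorem exists_cubic_character {H : Type*} [CommGroup H] [Fintype H] (h : 3 ∣ Fintype.card H) :
    ∃ χ : H →* ℂ, χ ≠ 1 ∧ ∀ g, χ g ^ 3 = 1 := by
  -- Duality turns an element of order 3 into a character of order 3.
  obtain ⟨e⟩ := CommGroup.monoidHom_mulEquiv_of_hasEnoughRootsOfUnity H ℂ
  have : Fact (Nat.Prime 3) := ⟨Nat.prime_three⟩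
  obtain ⟨g, hg⟩ := exists_prime_orderOf_dvd_card 3 h
  have hψ : orderOf (e.symm g) = 3 := by rw [MulEquiv.orderOf_eq, hg]
  refine ⟨(Units.coeHom ℂ).comp (e.symm g), fun h1 => ?_, fun x => ?_⟩
  · have : e.symm g = 1 := by
      ext x
      simpa using DFunLike.congr_fun h1 x
    rw [this, orderOf_one] at hψ
    omega
  · have h3 : (e.symm g) ^ 3 = 1 := by rw [← hψ]; exact pow_orderOf_eq_one _
    have := congrArg Units.val (DFunLike.congr_fun h3 x)
    simpa using this

/-- Both integers divide 4. The pairs `±(1, -4)` and their swaps fail by parity; `±(2, -2)` gives `8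
= 8n`. -/
theorem eq_one_of_int_eqs {m k n : ℤ} (hmk : m * k = -4)
    (hsq : m ^ 2 + k ^ 2 = 8 * n - 2 * (m + k)) : n = 1 := by
  have hbound : ∀ {a b : ℤ}, a * b = -4 → -4 ≤ a ∧ a ≤ 4 := fun {a b} h =>
    abs_le.mp (Int.le_of_dvd (by norm_num) ((abs_dvd a 4).mpr ⟨-b, by linear_combination h⟩))
  obtain ⟨hm1, hm2⟩ := hbound hmk
  obtain ⟨hk1, hk2⟩ := hbound (mul_comm k m ▸ hmk)
  interval_cases m <;> interval_cases k <;> omega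

/-- If `3` divides the order of `H`, then a solution exists only for `n = 1`. -/
theorem IsSolution.eq_one_of_three_dvd_card {H : Type*} [CommGroup H] [Fintype H] {n : ℕ}
    {T₀ T₁ : Finset H} (hT : IsSolution n T₀ T₁) (h : 3 ∣ Fintype.card H) : n = 1 := by
  obtain ⟨χ, hχ, h3⟩ := exists_cubic_character h
  have huniv : charHom χ (ofSubset (Finset.univ : Finset H)) = 0 := by
    rw [charHom_ofSubset, sum_hom_units_eq_zero χ hχ]
  have hmul := congrArg (charHom χ) hT.mul_eq
  have hsq := congrArg (charHom χ) hT.sq_add_sq_eq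
  simp only [map_mul, map_sub, map_add, map_pow, map_zsmul, map_one, huniv,
    charHom_powerMap_two, charHom_ofSubset, sum_sq_eq_sum h3 hT.inv_closed_zero,
    sum_sq_eq_sum h3 hT.inv_closed_one] at hmul hsq
  obtain ⟨m, hm⟩ := exists_int_eq_two_mul_sum h3 hT.inv_closed_zero
  obtain ⟨k, hk⟩ := exists_int_eq_two_mul_sum h3 hT.inv_closed_one
  simp only [zsmul_eq_mul] at hsq
  push_cast at hsq
  have hmk : m * k = -4 := by
    have : (m * k : ℂ) = -4 := by
      rw [← hm, ← hk]
      linear_combination 4 * hmul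
    exact_mod_cast this
  have hmk2 : m ^ 2 + k ^ 2 = 8 * (n : ℤ) - 2 * (m + k) := by
    have : (m ^ 2 + k ^ 2 : ℂ) = 8 * (n : ℂ) - 2 * (m + k) := by
      rw [← hm, ← hk]
      linear_combination 4 * hsq
    exact_mod_cast this
  exact_mod_cast eq_one_of_int_eqs hmk hmk2

end APLL

theorem theorem7p5 (n : ℕ) (hpos : 0 < n) (h6 : n ≡ 1 [MOD 6])
    (hn : n ≡ 0 [MOD 5] ∨
      (186 ≤ n ∧ n ≡ 1 [MOD 5]) ∨
      (125 ≤ n ∧ n ≡ 2 [MOD 5]) ∨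
      n ≡ 3 [MOD 5] ∨
      (83 ≤ n ∧ n ≡ 4 [MOD 5]))
    (H : Type*) [CommGroup H] [Fintype H] (hH : Fintype.card H = n ^ 2 + n + 1) :
    ¬ ∃ T₀ T₁ : Finset H, APLL.IsSolution n T₀ T₁ := by
  rintro ⟨T₀, T₁, hT⟩
  have h3 : 3 ∣ Fintype.card H := by
    obtain ⟨q, hq⟩ : ∃ q, n = 3 * q + 1 := ⟨n / 3, by unfold Nat.ModEq at h6; omega⟩
    rw [hH, hq]
    exact ⟨3 * q ^ 2 + 3 * q + 1, by ring⟩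
  have h1 := hT.eq_one_of_three_dvd_card h3
  -- `n = 1` lies in the class 1 mod 5, where `186 ≤ n` is required.
  unfold Nat.ModEq at hn
  omega
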